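/- For integers $g\ge 0$, $v\ge 1$ and $\mu_1,\dots,\mu_v\ge 0$, let the generalized Catalan number $C_{g,v}(\mu_1,\dots,\mu_v)$ be the number of isomorphism classes of connected graphs on the oriented closed surface of genus $g$ that give a cell decomposition of the surface, have $v$ labelled vertices of degrees $\mu_1,\dots,\mu_v$, and have one marked incident half-edge at each vertex of positive degree (so $C_{0,1}(0)=1$, for the one-vertex graph on the sphere). For real $b\ge 0$, $c>0$, the generalized $bc$-Motzkin numbers are $$\widetilde M_{g,v}(n_1,\dots,n_v;b,c)=\sum_{\mu_1=0}^{n_1}\cdots\sum_{\mu_v=0}^{n_v}\ \prod_{i=1}^v\binom{n_i}{\mu_i}\; C_{g,v}(\mu_1,\dots,\mu_v)\,b^{\sum_i n_i-\sum_i\mu_i}\,c^{\sum_i\mu_i}.$$ For a family of numbers $A_{g,v}(n_1,\dots,n_v)$, the discrete Laplace transform is $$F^A_{g,v}(x_1,\dots,x_v)=\sum_{n_1,\dots,n_v\ge 1}\frac{A_{g,v}(n_1,\dots,n_v)}{n_1\cdots n_v}\,x_1^{-n_1}\cdots x_v^{-n_v}\quad\text{for }(g,v)\ne(0,1),$$ $$F^A_{0,1}(x)=\sum_{n\ge1}\frac{A_{0,1}(n)}{n}\,x^{-n}-A_{0,1}(0)\log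 x ,$$ with the principal branch of $\log$. Let $F^{\widetilde M(b,c)}_{g,v}(t_1,\dots,t_v)$ be the transform of the numbers $\widetilde M_{g,v}(\,\cdot\,;b,c)$ with $x_i=x_i(t_i)$ given by $\frac{x_i-b}{c}=2+\frac{4}{t_i^2-1}$, and let $F^{C}_{g,v}(t_1,\dots,t_v)$ be the transform of the numbers $C_{g,v}$ with $x_i=2+\frac{4}{t_i^2-1}$. Then, for all $g\ge 0$, $v\ge1$, $b\ge0$, $c>0$ and all $t\in\mathbb C^v$ with $t_i\neq\pm1$ and $\left|b+c\left(2+\frac4{t_i^2-1}\right)\right|>b+2c$ for every $i$, the series defining $F^{\widetilde M(b,c)}_{g,v}(t)$ and $F^C_{g,v}(t)$ both converge absolutely, and $$F^{\widetilde M(b,c)}_{g,v}(t_1,\dots,t_v)=F^{C}_{g,v}(t_1,\dots,t_v)\quad\text{if }(g,v)\neq(0,1),$$ $$F^{\widetilde M(b,c)}_{0,1}(t)=F^{C}_{0,1}(t)-\log c$$ (so for $(g,v)=(0,1)$ the two functions agree up to an additive constant, and exactly when $c=1$). The same identities hold for analytic continuations in the $t$-variables: if $U\subseteq\mathbb C^v$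 is connected, $f$ and $h$ are analytic on (a neighbourhood of every point of) $U$, and near some point of $U$ satisfying the above inequalities $f=F^{\widetilde M(b,c)}_{g,v}$ and $h=F^C_{g,v}$, then on all of $U$ one has $f=h$ if $(g,v)\ne(0,1)$, and $f=h-\log c$ if $(g,v)=(0,1)$. -/

import Mathlib

open scoped Topology

namespace BCMotzkin

/-- The half-edges of a graph with vertices `0, …, v - 1` of degrees `μ 0, …, μ (v - 1)`. At each
vertex they are listed in counterclockwise order, starting with the half-edge marked by the
arrow. -/
abbrev HalfEdge {v : ℕ} (μ : Fin v → ℕ) : Type := Σ i : Fin v, Fin (μ i)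

/-- The rotation: each half-edge goes to the next one counterclockwise around its vertex. -/
def rotation {v : ℕ} (μ : Fin v → ℕ) : Equiv.Perm (HalfEdge μ) :=
  Equiv.sigmaCongrRight fun i => finRotate (μ i)

/-- The number of orbits (cycles, fixed points included) of a permutation. -/
noncomputable def numOrbits {H : Type} (π : Equiv.Perm H) : ℕ :=
  Nat.card (Quotient (Equiv.Perm.SameCycle.setoid π))

/-- The number of faces of the map whose edges are the pairs `{h, α h}`: the orbits of
`rotation μ * α`, and one face for each vertex of degree `0` (in a connected map such a vertex is
the whole graph, drawn on the sphere). -/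
noncomputable def numFaces {v : ℕ} (μ : Fin v → ℕ) (α : Equiv.Perm (HalfEdge μ)) : ℕ :=
  numOrbits (rotation μ * α) + (Finset.univ.filter fun i => μ i = 0).card

/-- The graph on the vertices in which two vertices are adjacent if an edge `{h, α h}` joins
them. -/
def vertexGraph {v : ℕ} (μ : Fin v → ℕ) (α : Equiv.Perm (HalfEdge μ)) : SimpleGraph (Fin v) :=
  SimpleGraph.fromRel fun i j => ∃ h : HalfEdge μ, h.1 = i ∧ (α h).1 = j

/-- `α` is the edge pairing of a Catalan graph of degree `μ` on the oriented surface of genus `g`: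
a connected graph giving a cell decomposition of the surface (so `V - E + F = 2 - 2 g`), with
labelled vertices of degrees `μ i` and one marked half-edge at every vertex of positive degree. As
the labels and arrows name all half-edges, isomorphism classes of Catalan graphs correspond
one-to-one to such pairings. -/
structure IsCatalanGraph (g : ℕ) {v : ℕ} (μ : Fin v → ℕ) (α : Equiv.Perm (HalfEdge μ)) :
    Prop where
  involutive : ∀ h, α (α h) = h
  fixedPointFree : ∀ h, α h ≠ h
  connected : (vertexGraph μ α).Connected
  euler : (v : ℤ) - (((∑ i, μ i) / 2 : ℕ) : ℤ) + (numFaces μ α : ℤ) = 2 - 2 * (g : ℤ)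

/-- The generalized Catalan number `C_{g,v}(μ_1, …, μ_v)`: the number of Catalan graphs. -/
noncomputable def catalanNumber (g : ℕ) {v : ℕ} (μ : Fin v → ℕ) : ℕ :=
  Nat.card {α : Equiv.Perm (HalfEdge μ) // IsCatalanGraph g μ α}

/-- The generalized `bc`-Motzkin number `M_{g,v}(n_1, …, n_v; b, c)`. The sum is over all `μ` with
`0 ≤ μ i ≤ n i` for every `i`. -/
noncomputable def motzkinNumber (b c : ℝ) (g : ℕ) {v : ℕ} (n : Fin v → ℕ) : ℝ :=
  ∑ μ ∈ Fintype.piFinset fun i => Finset.range (n i + 1),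
    (∏ i, ((n i).choose (μ i) : ℝ)) * (catalanNumber g μ : ℝ) *
      b ^ (∑ i, n i - ∑ i, μ i) * c ^ (∑ i, μ i)

/-- The term `A(n_1, …, n_v) / (n_1 ⋯ n_v) * x_1 ^ (-n_1) ⋯ x_v ^ (-n_v)` of the discrete Laplace
transform, where all `n_i ≥ 1`. -/
noncomputable def laplaceTerm {v : ℕ} (A : (Fin v → ℕ) → ℝ) (x : Fin v → ℂ) (n : Fin v → ℕ+) : ℂ :=
  (A (fun i => (n i : ℕ)) : ℂ) / ∏ i, (((n i : ℕ) : ℂ) * x i ^ (n i : ℕ))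

/-- The discrete Laplace transform of the numbers `A(n_1, …, n_v)` of type `(g, v)`, as a function
of `x_1, …, x_v`. For `(g, v) = (0, 1)` the term `A(0) log x_1` is subtracted (principal branch);
the sum over `i` then has the single term `i = 0`. -/
noncomputable def discreteLaplace (g : ℕ) {v : ℕ} (A : (Fin v → ℕ) → ℝ) (x : Fin v → ℂ) : ℂ :=
  (∑' n : Fin v → ℕ+, laplaceTerm A x n) -
    if g = 0 ∧ v = 1 then (A (fun _ => 0) : ℂ) * ∑ i, Complex.log (x i) else 0

/-- The change of variable `(x - b) / c = 2 + 4 / (t ^ 2 - 1)`, solved for `x`, in each of the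
`v` variables. -/
noncomputable def xOfT (b c : ℝ) {v : ℕ} (t : Fin v → ℂ) : Fin v → ℂ :=
  fun i => (b : ℂ) + (c : ℂ) * (2 + 4 / (t i ^ 2 - 1))

/-- The numbers `A(n) = C_{g,v}(n)`, as real numbers. -/
noncomputable def catalanReal (g v : ℕ) : (Fin v → ℕ) → ℝ := fun n => (catalanNumber g n : ℝ)

/-- `F^C_{g,v}(t_1, …, t_v)`: here `x_i = 2 + 4 / (t_i ^ 2 - 1)`. -/
noncomputable def catalanF (g v : ℕ) (t : Fin v → ℂ) : ℂ :=
  discreteLaplace g (catalanReal g v) (xOfT 0 1 t)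

/-- `F^{M(b,c)}_{g,v}(t_1, …, t_v)`: here `(x_i - b) / c = 2 + 4 / (t_i ^ 2 - 1)`. -/
noncomputable def motzkinF (b c : ℝ) (g v : ℕ) (t : Fin v → ℂ) : ℂ :=
  discreteLaplace g (motzkinNumber b c g) (xOfT b c t)

/-- The points `t` with `t_i ≠ ±1` and `|x_i(t_i)| > b + 2 c` for all `i`: a neighbourhood of
`x = ∞` in the `x`-variables. -/
def laplaceDomain (b c : ℝ) (v : ℕ) : Set (Fin v → ℂ) :=
  {t | ∀ i, t i ^ 2 ≠ 1 ∧ b + 2 * c < ‖xOfT b c t i‖}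

end BCMotzkin

namespace BCMotzkin

/-! Expand the `bc`-Motzkin numbers as binomial sums of Catalan numbers and sum over the `n_i`
first. Since `choose n m / n = choose (n-1) (m-1) / m`, the negative binomial series gives, for `m ≥
1`, `∑ n, choose n m * b^(n-m) * c^m / (n * x^n) = (c / (x - b))^m / m`, which is the Catalan term
at `y = (x - b) / c`. For `m = 0` the sum is `-log (1 - b / x)`. A vertex of degree `0` occurs only
for `(g, v) = (0, 1)`; there `log (1 - b / x) + log x = log (x - b) = log c + log y`, whence the
constant `-log c`.

The interchange of sums needs absolute convergence for `|x_i| > b + 2 * c`, that is, Catalan numbers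
bounded by `2 ^ (∑ μ i)` times a polynomial (`catalanNumber_le`). This is proved by encoding. Order
the half-edges along the vertices. Apart from the last half-edge of each vertex, a half-edge `h`
that discovers a face satisfies `h < α h`. By Euler's formula there are almost half as many faces as
half-edges, so all but boundedly many half-edges are discoverers or their partners. The set of
discoverers and bounded exceptional data determine `α` (`involution_ext`).

Analytic continuations are then compared by the identity theorem. -/

/-- The least element, in a linear order, of the orbit of `h`. -/
noncomputable def orbitMin {H : Type} [Fintype H] [LinearOrder H] (π : Equiv.Perm H) (h : H) : H :=
  open Classical in
  (Finset.univ.filter fun k => π.SameCycle h k).min'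
    ⟨h, by simp [Equiv.Perm.SameCycle.refl]⟩

/-! ### Least elements of orbits as names for the faces. -/

section OrbitMin

variable {H : Type} [Fintype H] [LinearOrder H] (π : Equiv.Perm H)

theorem sameCycle_orbitMin (h : H) : π.SameCycle h (orbitMin π h) := by
  classical
  have := Finset.min'_mem (Finset.univ.filter fun k => π.SameCycle h k)
    ⟨h, by simp [Equiv.Perm.SameCycle.refl]⟩
  unfold orbitMin
  simpa using this

variable {π}

theorem orbitMin_le {h k : H} (hk : π.SameCycle h k) : orbitMin π h ≤ k := by
  classical
  exact Finset.min'_le _ _ (by simpa using hk)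

theorem orbitMin_congr {h k : H} (hk : π.SameCycle h k) : orbitMin π h = orbitMin π k :=
  le_antisymm (orbitMin_le (hk.trans (sameCycle_orbitMin π k)))
    (orbitMin_le (hk.symm.trans (sameCycle_orbitMin π h)))

variable (π)

theorem orbitMin_apply (h : H) : orbitMin π (π h) = orbitMin π h :=
  orbitMin_congr (Equiv.Perm.sameCycle_apply_left.2 (Equiv.Perm.SameCycle.refl _ _))

theorem orbitMin_orbitMin (h : H) : orbitMin π (orbitMin π h) = orbitMin π h :=
  (orbitMin_congr (sameCycle_orbitMin π h)).symm

theorem numOrbits_le_card_orbitMin :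
    numOrbits π ≤ (Finset.univ.filter fun h => orbitMin π h = h).card := by
  classical
  have h1 : numOrbits π ≤ Nat.card {h : H // orbitMin π h = h} := by
    refine Nat.card_le_card_of_injective
      (Quotient.lift (fun h => (⟨orbitMin π h, orbitMin_orbitMin π h⟩ : {h : H // orbitMin π h = h}))
        fun a b hab => Subtype.ext (orbitMin_congr hab)) ?_
    rintro ⟨a⟩ ⟨b⟩ hab
    have hab : orbitMin π a = orbitMin π b := congrArg Subtype.val hab
    refine Quotient.sound ((sameCycle_orbitMin π a).trans ?_)
    rw [hab]
    exact (sameCycle_orbitMin π b).symm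
  rwa [Nat.card_eq_fintype_card, Fintype.card_subtype] at h1

end OrbitMin

/-! ### Encoding an involution by its discovery set and exceptional data. -/

section Encoding

variable {H : Type} [Fintype H] [LinearOrder H] (σ : Equiv.Perm H) (L : Finset H)
  (α : Equiv.Perm H)

/-- The half-edges `h` such that a face of the map is first visited at `σ h`, apart from those
in `L`. -/
noncomputable def discoverySet : Finset H :=
  Finset.univ.filter fun h => h ∉ L ∧ orbitMin (σ * α) (σ h) = σ h

/-- The half-edges in `L`, and those which neither discover a face nor are paired with one that
does. -/
noncomputable def exceptionalSet : Finset H :=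
  (Finset.univ \ (discoverySet σ L α ∪ (discoverySet σ L α).image α)) ∪ L

/-- The exceptional half-edges `h`, each with its partner and with the face at `σ h`. -/
noncomputable def exceptionalGraph : Finset (H × H × H) :=
  (exceptionalSet σ L α).image fun h => (h, α h, orbitMin (σ * α) (σ h))

variable {σ L α}

theorem mem_discoverySet {h : H} :
    h ∈ discoverySet σ L α ↔ h ∉ L ∧ orbitMin (σ * α) (σ h) = σ h := by
  simp [discoverySet]

/-- The permutation `σ * α` sends `α h` to `σ h`, so both lie on the same face. -/
theorem orbitMin_rotation (hα : ∀ h, α (α h) = h) (h : H) :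
    orbitMin (σ * α) (σ h) = orbitMin (σ * α) (α h) := by
  rw [← orbitMin_apply (σ * α) (α h), Equiv.Perm.mul_apply, hα]

theorem lt_of_mem_discoverySet (hL : ∀ h ∉ L, h < σ h) (hα : ∀ h, α (α h) = h) {h : H}
    (hh : h ∈ discoverySet σ L α) : h < α h := by
  obtain ⟨h1, h2⟩ := mem_discoverySet.1 hh
  refine (hL h h1).trans_le ?_
  rw [← h2, orbitMin_rotation hα]
  exact orbitMin_le (Equiv.Perm.SameCycle.refl _ _)

theorem notMem_discoverySet (hL : ∀ h ∉ L, h < σ h) (hα : ∀ h, α (α h) = h) {h : H}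
    (hh : h ∈ discoverySet σ L α) : α h ∉ discoverySet σ L α := fun hh' => by
  have h1 := lt_of_mem_discoverySet hL hα hh
  have h2 := lt_of_mem_discoverySet hL hα hh'
  rw [hα] at h2
  exact lt_asymm h1 h2

/-- Every face has a discoverer, in `L` or in the discovery set `D`, so there are at most `|D| +
|L|` faces. As `D` and its image under `α` are disjoint, at most `|H| - 2|D| + |L|` half-edges are
exceptional. -/
theorem card_exceptionalSet_add_le (hL : ∀ h ∉ L, h < σ h) (hα : ∀ h, α (α h) = h) :
    (exceptionalSet σ L α).card + 2 * numOrbits (σ * α) ≤ Fintype.card H + 3 * L.card := by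
  have hF : numOrbits (σ * α) ≤ (discoverySet σ L α).card + L.card := by
    refine (numOrbits_le_card_orbitMin _).trans ?_
    rw [← Finset.card_map (s := Finset.filter _ _) σ.symm.toEmbedding]
    refine (Finset.card_le_card ?_).trans (Finset.card_union_le _ _)
    intro h hh
    simp only [Finset.mem_map_equiv, Equiv.symm_symm, Finset.mem_filter, Finset.mem_univ,
      true_and] at hh
    by_cases hl : h ∈ L
    · exact Finset.mem_union_right _ hl
    · exact Finset.mem_union_left _ (mem_discoverySet.2 ⟨hl, hh⟩)
  have hdisj : Disjoint (discoverySet σ L α) ((discoverySet σ L α).image α) := by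
    rw [Finset.disjoint_left]
    intro h hh hh'
    obtain ⟨k, hk, rfl⟩ := Finset.mem_image.1 hh'
    exact notMem_discoverySet hL hα hk hh
  have h2 : (discoverySet σ L α ∪ (discoverySet σ L α).image α).card =
      2 * (discoverySet σ L α).card := by
    rw [Finset.card_union_of_disjoint hdisj, Finset.card_image_of_injective _ α.injective]
    ring
  have h3 : (Finset.univ \ (discoverySet σ L α ∪ (discoverySet σ L α).image α)).card +
      2 * (discoverySet σ L α).card = Fintype.card H := by
    rw [← h2, Finset.card_sdiff_add_card_eq_card (Finset.subset_univ _), Finset.card_univ]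
  have h4 := Finset.card_union_le
    (Finset.univ \ (discoverySet σ L α ∪ (discoverySet σ L α).image α)) L
  unfold exceptionalSet
  omega

theorem apply_eq_of_notMem_exceptionalSet (hα : ∀ h, α (α h) = h) {h : H}
    (hD : h ∉ discoverySet σ L α) (hE : h ∉ exceptionalSet σ L α) :
    α h ∈ discoverySet σ L α ∧ σ (α h) = orbitMin (σ * α) h := by
  have h1 : α h ∈ discoverySet σ L α := by
    by_contra h2
    refine hE (Finset.mem_union_left _ (Finset.mem_sdiff.2 ⟨Finset.mem_univ _, fun h3 => ?_⟩))
    obtain h3 | h3 := Finset.mem_union.1 h3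
    · exact hD h3
    · obtain ⟨k, hk, rfl⟩ := Finset.mem_image.1 h3
      exact h2 (by rwa [hα])
  refine ⟨h1, ?_⟩
  rw [← (mem_discoverySet.1 h1).2, ← Equiv.Perm.mul_apply σ α h, orbitMin_apply]

theorem mem_exceptionalGraph {t : H × H × H} : t ∈ exceptionalGraph σ L α ↔
    t.1 ∈ exceptionalSet σ L α ∧ t.2.1 = α t.1 ∧ t.2.2 = orbitMin (σ * α) (σ t.1) := by
  obtain ⟨a, b, c⟩ := t
  simp only [exceptionalGraph, Finset.mem_image, Prod.mk.injEq]
  constructor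
  · rintro ⟨h, hh, rfl, rfl, rfl⟩
    exact ⟨hh, rfl, rfl⟩
  · rintro ⟨h1, rfl, rfl⟩
    exact ⟨a, h1, rfl, rfl, rfl⟩

/-- An involution is determined by its discovery set and its exceptional graph. -/
theorem involution_ext (hL : ∀ h ∉ L, h < σ h) {β : Equiv.Perm H}
    (hα : ∀ h, α (α h) = h) (hβ : ∀ h, β (β h) = h)
    (hD : discoverySet σ L α = discoverySet σ L β)
    (hG : exceptionalGraph σ L α = exceptionalGraph σ L β) : α = β := by
  have hE : ∀ h ∈ exceptionalSet σ L α, h ∈ exceptionalSet σ L β ∧ α h = β h ∧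
      orbitMin (σ * α) (σ h) = orbitMin (σ * β) (σ h) := fun h hh => by
    have h1 : (h, α h, orbitMin (σ * α) (σ h)) ∈ exceptionalGraph σ L α :=
      mem_exceptionalGraph.2 ⟨hh, rfl, rfl⟩
    rw [hG] at h1
    exact mem_exceptionalGraph.1 h1
  have hE' : ∀ h ∈ exceptionalSet σ L β, h ∈ exceptionalSet σ L α := fun h hh => by
    have h1 : (h, β h, orbitMin (σ * β) (σ h)) ∈ exceptionalGraph σ L β :=
      mem_exceptionalGraph.2 ⟨hh, rfl, rfl⟩
    rw [← hG] at h1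
    exact (mem_exceptionalGraph.1 h1).1
  -- Outside the discovery set, the partner is either recorded in the graph or is the discoverer of
  -- the face of `h`, hence `σ⁻¹` of the minimum of that face.
  have key : ∀ h, orbitMin (σ * α) h = orbitMin (σ * β) h → h ∉ discoverySet σ L α →
      α h = β h := fun h hm hd => by
    by_cases he : h ∈ exceptionalSet σ L α
    · exact (hE h he).2.1
    · have h1 := (apply_eq_of_notMem_exceptionalSet hα hd he).2
      have h2 := (apply_eq_of_notMem_exceptionalSet hβ (hD ▸ hd) fun h' => he (hE' h h')).2
      exact σ.injective (h1.trans (hm.trans h2.symm))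
  -- Induction along the order: the face at `σ k` is recorded, newly discovered, or the face of `α
  -- k`. In the last case `α k < k < σ k`, and `α k = β k` by induction at `k`.
  have hm : ∀ h, orbitMin (σ * α) h = orbitMin (σ * β) h := by
    intro h
    induction h using WellFoundedLT.induction with
    | ind h ih =>
    obtain ⟨k, rfl⟩ := σ.surjective h
    by_cases he : k ∈ exceptionalSet σ L α
    · exact (hE k he).2.2
    have hk : k < σ k := hL k fun hl => he (Finset.mem_union_right _ hl)
    by_cases hd : k ∈ discoverySet σ L α
    · rw [(mem_discoverySet.1 hd).2, (mem_discoverySet.1 (hD ▸ hd)).2]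
    have hα' := (apply_eq_of_notMem_exceptionalSet hα hd he).1
    have hlt : α k < k := by simpa only [hα] using lt_of_mem_discoverySet hL hα hα'
    rw [orbitMin_rotation hα, orbitMin_rotation hβ, ← key k (ih k hk) hd]
    exact ih _ (hlt.trans hk)
  ext h
  by_cases hd : h ∈ discoverySet σ L α
  -- The partner of a discoverer is not a discoverer, so `key` applies to it.
  · have h1 := key (α h) (hm _) (notMem_discoverySet hL hα hd)
    rw [hα] at h1
    rw [← hβ (α h), ← h1]
  · exact key h (hm h) hd

end Encoding

/-! ### Exponential growth bound and degree-zero values for the Catalan numbers. -/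

/-- A finite set of at most `K` elements is the set of values of a sequence of length `K`. -/
theorem exists_enumeration {T : Type} (S : Finset T) {K : ℕ} (hS : S.card ≤ K) :
    ∃ e : Fin K → Option T, ∀ t, t ∈ S ↔ ∃ k, e k = some t := by
  refine ⟨fun k => if h : (k : ℕ) < S.card then some (S.equivFin.symm ⟨k, h⟩ : T) else none,
    fun t => ⟨fun ht => ?_, ?_⟩⟩
  · refine ⟨⟨S.equivFin ⟨t, ht⟩, (S.equivFin ⟨t, ht⟩).2.trans_le hS⟩, ?_⟩
    simp
  · rintro ⟨k, hk⟩
    beta_reduce at hk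
    split_ifs at hk with h
    rw [← Option.some.inj hk]
    exact Subtype.prop _

/-- A bound for the number of involutions `α` such that `σ * α` has many orbits. -/
theorem card_involutions_le {H : Type} [Fintype H] (p : H → ℕ) (hp : Function.Injective p)
    (σ : Equiv.Perm H) (L : Finset H) (hL : ∀ h ∉ L, p h < p (σ h)) (K : ℕ) (P : Equiv.Perm H → Prop)
    (hinv : ∀ α, P α → ∀ h, α (α h) = h)
    (hK : ∀ α, P α → Fintype.card H + 3 * L.card ≤ 2 * numOrbits (σ * α) + K) :
    Nat.card {α // P α} ≤ 2 ^ Fintype.card H * (Fintype.card H ^ 3 + 1) ^ K := by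
  let : LinearOrder H := LinearOrder.lift' p hp
  have hex : ∀ α : {α // P α}, ∃ e : Fin K → Option (H × H × H),
      ∀ t, t ∈ exceptionalGraph σ L α.1 ↔ ∃ k, e k = some t := fun α => by
    refine exists_enumeration _ (Finset.card_image_le.trans ?_)
    have h1 := card_exceptionalSet_add_le hL (hinv α.1 α.2)
    have h2 := hK α.1 α.2
    omega
  choose e he using hex
  have hinj : Function.Injective fun α : {α // P α} => (discoverySet σ L α.1, e α) := by
    intro α β hαβ
    obtain ⟨h1, h2⟩ := Prod.mk.inj hαβ
    refine Subtype.ext (involution_ext hL (hinv _ α.2) (hinv _ β.2) h1 ?_)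
    ext t
    rw [he, he, h2]
  refine (Nat.card_le_card_of_injective _ hinj).trans (le_of_eq ?_)
  simp only [Nat.card_eq_fintype_card, Fintype.card_prod, Fintype.card_finset,
    Fintype.card_pi_const, Fintype.card_option]
  ring

theorem rotation_mk {v : ℕ} (μ : Fin v → ℕ) (i : Fin v) (k : Fin (μ i)) (hk : (k : ℕ) + 1 < μ i) :
    rotation μ ⟨i, k⟩ = ⟨i, ⟨k + 1, hk⟩⟩ := by
  have h : ∀ (m : ℕ) (k : Fin m) (hk : (k : ℕ) + 1 < m), finRotate m k = ⟨k + 1, hk⟩ := by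
    intro m k hk
    cases m with
    | zero => exact k.elim0
    | succ m => exact finRotate_of_lt (by omega)
  exact congrArg (Sigma.mk i) (h _ k hk)

/-- The generalized Catalan numbers grow at most like `2 ^ (∑ i, μ i)`, up to a polynomial. -/
theorem catalanNumber_le (g : ℕ) {v : ℕ} (μ : Fin v → ℕ) :
    catalanNumber g μ ≤ 2 ^ (∑ i, μ i) * ((∑ i, μ i) ^ 3 + 1) ^ (4 * g + 7 * v) := by
  have hcard : Fintype.card (HalfEdge μ) = ∑ i, μ i := by simp
  -- The last half-edge at each vertex: every other one is raised by the rotation in the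
  -- lexicographic order of `finSigmaFinEquiv`.
  let L : Finset (HalfEdge μ) := Finset.univ.filter fun h => (h.2 : ℕ) + 1 = μ h.1
  have hLcard : L.card ≤ v := by
    have : L.card ≤ (Finset.univ : Finset (Fin v)).card := by
      refine Finset.card_le_card_of_injOn Sigma.fst
        (fun _ _ => Finset.mem_coe.2 (Finset.mem_univ _)) ?_
      rintro ⟨i, k⟩ hk ⟨j, l⟩ hl hij
      obtain rfl : i = j := hij
      simp only [L, Finset.coe_filter, Finset.mem_univ, true_and, Set.mem_ofPred_eq] at hk hl
      congr 1
      ext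
      omega
    simpa using this
  have hL : ∀ h ∉ L,
      (finSigmaFinEquiv h : ℕ) < (finSigmaFinEquiv (rotation μ h) : ℕ) := by
    rintro ⟨i, k⟩ hk
    simp only [L, Finset.mem_filter, Finset.mem_univ, true_and] at hk
    rw [rotation_mk μ i k (by omega)]
    rw [finSigmaFinEquiv_apply, finSigmaFinEquiv_apply]
    simp
  rw [← hcard]
  -- In `4 * g + 7 * v`, twice Euler's formula costs `4 * g + 2 * v`, the faces of degree-zero
  -- vertices `2 * v`, and `3 * L.card` at most `3 * v`. The constant `4` from Euler's formula
  -- absorbs the rounding in `(∑ i, μ i) / 2`.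
  refine card_involutions_le _ (Fin.val_injective.comp finSigmaFinEquiv.injective) (rotation μ)
    L hL _ _ (fun α hα => hα.involutive) fun α hα => ?_
  have h1 := hα.euler
  have h2 : (Finset.univ.filter fun i => μ i = 0).card ≤ v := by
    simpa using Finset.card_filter_le (Finset.univ : Finset (Fin v)) fun i => μ i = 0
  rw [hcard]
  unfold numFaces at h1
  omega

/-- A vertex of degree `0` is isolated, so connectedness forces `v = 1`; then there is one face and
no edge, and Euler's formula gives `g = 0`. -/
theorem catalanNumber_eq_zero (g : ℕ) {v : ℕ} (μ : Fin v → ℕ) (hv : ¬ (g = 0 ∧ v = 1))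
    {i : Fin v} (hi : μ i = 0) : catalanNumber g μ = 0 := by
  unfold catalanNumber
  have : IsEmpty {α : Equiv.Perm (HalfEdge μ) // IsCatalanGraph g μ α} := by
    refine ⟨fun ⟨α, hα⟩ => ?_⟩
    have hadj : ∀ j, ¬ (vertexGraph μ α).Adj i j := by
      intro j hj
      simp only [vertexGraph, SimpleGraph.fromRel_adj] at hj
      obtain ⟨-, ⟨h, rfl, -⟩ | ⟨h, -, h2⟩⟩ := hj
      · have := h.2.2
        omega
      · have := (α h).2.2
        have h3 : μ (α h).1 = 0 := by rw [h2, hi]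
        omega
    have hsub : ∀ j, j = i := by
      intro j
      by_contra hne
      have : Nontrivial (Fin v) := ⟨j, i, hne⟩
      obtain ⟨k, hk⟩ := hα.connected.preconnected.exists_adj_of_nontrivial i
      exact hadj k hk
    have hv1 : v = 1 := by
      have : Fintype.card (Fin v) = 1 := Fintype.card_eq_one_iff.2 ⟨i, hsub⟩
      simpa using this
    subst hv1
    have hμ : ∀ j, μ j = 0 := fun j => by rw [hsub j, hi]
    have : IsEmpty (HalfEdge μ) := ⟨fun h => by have := h.2.2; have := hμ h.1; omega⟩
    have h1 := hα.euler
    have h2 : numOrbits (rotation μ * α) = 0 := by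
      unfold numOrbits
      have : IsEmpty (Quotient (Equiv.Perm.SameCycle.setoid (rotation μ * α))) :=
        ⟨fun q => Quotient.inductionOn q fun h => isEmptyElim h⟩
      exact Nat.card_of_isEmpty
    simp only [numFaces, h2, hμ] at h1
    simp at h1
    omega
  exact Nat.card_of_isEmpty

theorem catalanNumber_zero : catalanNumber 0 (fun _ : Fin 1 => 0) = 1 := by
  have : IsEmpty (HalfEdge fun _ : Fin 1 => 0) := ⟨fun h => h.2.elim0⟩
  unfold catalanNumber
  rw [Nat.card_eq_one_iff_unique]
  refine ⟨inferInstance, ⟨1, fun h => isEmptyElim h, fun h => isEmptyElim h, ?_, ?_⟩⟩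
  · exact { preconnected := fun a b => by rw [Subsingleton.elim a b] }
  · have h2 : numOrbits (rotation (fun _ : Fin 1 => 0) * 1) = 0 := by
      unfold numOrbits
      have : IsEmpty (Quotient (Equiv.Perm.SameCycle.setoid
        (rotation (fun _ : Fin 1 => 0) * 1))) := ⟨fun q => Quotient.inductionOn q fun h => isEmptyElim h⟩
      exact Nat.card_of_isEmpty
    rw [numFaces, h2]
    simp

/-! ### Absolutely convergent products of series in separate variables. -/

section Products

theorem summable_norm_prod_and_tsum {𝕜 β : Type*} [NormedField 𝕜] [CompleteSpace 𝕜] {v : ℕ}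
    (f : Fin v → β → 𝕜) (hf : ∀ i, Summable fun n => ‖f i n‖) :
    (Summable fun n : Fin v → β => ‖∏ i, f i (n i)‖) ∧
      ∑' n : Fin v → β, ∏ i, f i (n i) = ∏ i, ∑' n, f i n := by
  induction v with
  | zero =>
    refine ⟨(hasSum_fintype _).summable, ?_⟩
    simp
  | succ v ih =>
    obtain ⟨h1, h2⟩ := ih (fun i => f i.succ) fun i => hf i.succ
    let e := Fin.consEquiv fun _ : Fin (v + 1) => β
    have he : ∀ p : β × (Fin v → β),
        ∏ i, f i (e p i) = f 0 p.1 * ∏ i : Fin v, f i.succ (p.2 i) := fun p => by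
      rw [Fin.prod_univ_succ]
      simp [e, Fin.consEquiv]
    constructor
    · rw [← e.summable_iff]
      have := (hf 0).mul_norm h1
      refine this.congr fun p => ?_
      simp only [Function.comp_apply, he]
    · rw [← e.tsum_eq, tsum_congr he, Fin.prod_univ_succ, ← h2,
        tsum_mul_tsum_of_summable_norm (hf 0) h1]

theorem hasSum_prod {𝕜 β : Type*} [NormedField 𝕜] [CompleteSpace 𝕜] {v : ℕ}
    (f : Fin v → β → 𝕜) (hf : ∀ i, Summable fun n => ‖f i n‖) :
    HasSum (fun n : Fin v → β => ∏ i, f i (n i)) (∏ i, ∑' n, f i n) := by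
  obtain ⟨h1, h2⟩ := summable_norm_prod_and_tsum f hf
  rw [← h2]
  exact h1.of_norm.hasSum

end Products

/-! ### The one-variable sum over `n`. -/

section Kernel

/-- The coefficient with which a degree `m` contributes to the term with exponent `n` of the
discrete Laplace transform, in one variable. -/
noncomputable def laplaceKernel {𝕜 : Type*} [Field 𝕜] (b c x : 𝕜) (m : ℕ) (n : ℕ+) : 𝕜 :=
  ((n : ℕ).choose m : 𝕜) * b ^ ((n : ℕ) - m) * c ^ m / (((n : ℕ) : 𝕜) * x ^ (n : ℕ))

theorem hasSum_laplaceKernel {𝕜 : Type*} [RCLike 𝕜] {b x : 𝕜} (c : 𝕜) (hx : ‖b‖ < ‖x‖) {m : ℕ}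
    (hm : m ≠ 0) : HasSum (laplaceKernel b c x m) ((c / (x - b)) ^ m / m) := by
  obtain ⟨k, rfl⟩ := Nat.exists_eq_succ_of_ne_zero hm
  have hx0 : x ≠ 0 := norm_pos_iff.1 ((norm_nonneg b).trans_lt hx)
  have hxb : x - b ≠ 0 := sub_ne_zero.2 fun h => by simp [h] at hx
  have hr : ‖b / x‖ < 1 := by
    rw [norm_div, div_lt_one (norm_pos_iff.2 hx0)]
    exact hx
  rw [← Equiv.pnatEquivNat.symm.hasSum_iff]
  have hinj : Function.Injective fun i : ℕ => i + k := add_left_injective k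
  rw [← hinj.hasSum_iff]
  -- With `m = k + 1` and `n = i + k + 1` this is the negative binomial series in `b / x`; the
  -- skipped terms have `n < m` and vanish.
  · have h1 := (hasSum_choose_mul_geometric_of_norm_lt_one k hr).mul_left
      (c ^ (k + 1) / (x ^ (k + 1) * (k + 1 : 𝕜)))
    convert! h1 using 1
    · ext i
      have h2 : ((i + k : ℕ) + 1 : 𝕜) * ((i + k).choose k : 𝕜) =
          ((i + k + 1).choose (k + 1) : 𝕜) * (k + 1 : 𝕜) := by
        exact_mod_cast Nat.add_one_mul_choose_eq (i + k) k
      have h3 : ((i + k : ℕ) + 1 : 𝕜) ≠ 0 := Nat.cast_add_one_ne_zero _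
      have h4 : (k + 1 : 𝕜) ≠ 0 := Nat.cast_add_one_ne_zero _
      simp only [Function.comp_apply, laplaceKernel, Equiv.pnatEquivNat_symm_apply,
        Nat.succPNat_coe, Nat.succ_eq_add_one]
      rw [show i + k + 1 - (k + 1) = i by omega]
      have h5 : ((i + k + 1).choose (k + 1) : 𝕜) =
          ((i + k : ℕ) + 1 : 𝕜) * ((i + k).choose k : 𝕜) / (k + 1 : 𝕜) := by
        rw [h2]
        field_simp
      rw [h5]
      push_cast at h3 ⊢
      rw [div_pow]
      field_simp
      ring
    · have h4 : (k + 1 : 𝕜) ≠ 0 := Nat.cast_add_one_ne_zero _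
      rw [show (1 : 𝕜) - b / x = (x - b) / x by field_simp]
      simp only [Nat.succ_eq_add_one, div_pow]
      push_cast
      field_simp
  · intro j hj
    have : j < k := by
      by_contra h
      exact hj ⟨j - k, Nat.sub_add_cancel (not_lt.1 h)⟩
    simp [laplaceKernel, Nat.choose_eq_zero_of_lt (Nat.succ_lt_succ this)]

theorem hasSum_laplaceKernel_zero {b x : ℂ} (c : ℂ) (hx : ‖b‖ < ‖x‖) :
    HasSum (laplaceKernel b c x 0) (-Complex.log (1 - b / x)) := by
  have hx0 : x ≠ 0 := norm_pos_iff.1 ((norm_nonneg b).trans_lt hx)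
  have hr : ‖b / x‖ < 1 := by
    rw [norm_div, div_lt_one (norm_pos_iff.2 hx0)]
    exact hx
  rw [← Equiv.pnatEquivNat.symm.hasSum_iff]
  convert! Complex.hasSum_taylorSeries_neg_log' hr using 1
  ext n
  simp [laplaceKernel, div_pow]
  field_simp

theorem norm_laplaceKernel {b c : ℝ} (hb : 0 ≤ b) (hc : 0 ≤ c) (x : ℂ) (m : ℕ) (n : ℕ+) :
    ‖laplaceKernel (b : ℂ) (c : ℂ) x m n‖ = laplaceKernel b c ‖x‖ m n := by
  simp [laplaceKernel, abs_of_nonneg hb, abs_of_nonneg hc]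

theorem summable_norm_laplaceKernel {b c : ℝ} (hb : 0 ≤ b) (hc : 0 ≤ c) {x : ℂ} (hx : b < ‖x‖)
    (m : ℕ) : Summable fun n => ‖laplaceKernel (b : ℂ) (c : ℂ) x m n‖ := by
  rcases eq_or_ne m 0 with rfl | hm
  -- The norms are the terms of the logarithmic series at the positive real point `‖x‖`.
  · have hx' : ‖(b : ℂ)‖ < ‖((‖x‖ : ℝ) : ℂ)‖ := by simpa [abs_of_nonneg hb] using hx
    refine (hasSum_laplaceKernel_zero (c : ℂ) hx').summable.norm.congr fun n => ?_
    rw [norm_laplaceKernel hb hc, norm_laplaceKernel hb hc]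
    simp
  · simp only [norm_laplaceKernel hb hc]
    exact (hasSum_laplaceKernel c (by simpa [abs_of_nonneg hb] using hx) hm).summable

end Kernel

/-! ### Convergence of sums weighted by Catalan numbers. -/

section CatalanSums

theorem one_add_sum_le_prod {v : ℕ} (n : Fin v → ℕ) : ∑ i, n i + 1 ≤ ∏ i, (n i + 1) := by
  induction v with
  | zero => simp
  | succ v ih =>
    rw [Fin.sum_univ_succ, Fin.prod_univ_succ]
    nlinarith [ih fun i => n i.succ, Nat.zero_le (∑ i : Fin v, n i.succ)]

/-- Replacing the polynomial in `∑ i, n i` by a product separates the variables. -/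
theorem catalanNumber_le_prod (g : ℕ) {v : ℕ} (n : Fin v → ℕ) :
    catalanNumber g n ≤ ∏ i, 2 ^ n i * (n i + 1) ^ (3 * (4 * g + 7 * v)) := by
  refine (catalanNumber_le g n).trans ?_
  rw [Finset.prod_mul_distrib, Finset.prod_pow_eq_pow_sum, Finset.prod_pow, pow_mul]
  refine Nat.mul_le_mul_left _ (Nat.pow_le_pow_left ?_ _)
  refine le_trans ?_ (Nat.pow_le_pow_left (one_add_sum_le_prod n) 3)
  generalize ∑ i, n i = N
  nlinarith [Nat.zero_le N, Nat.zero_le (N ^ 2)]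

theorem summable_catalanNumber (g : ℕ) {v : ℕ} {r : Fin v → ℝ} (hr : ∀ i, 0 ≤ r i)
    (hr' : ∀ i, r i < 1 / 2) :
    Summable fun n : Fin v → ℕ+ => (catalanNumber g fun i => (n i : ℕ)) * ∏ i, r i ^ (n i : ℕ) := by
  set k := 3 * (4 * g + 7 * v)
  have h1 : ∀ i, Summable fun n : ℕ+ => ‖((n : ℕ) + 1 : ℝ) ^ k * (2 * r i) ^ (n : ℕ)‖ := fun i => by
    have h2 : ‖2 * r i‖ < 1 := by
      rw [Real.norm_of_nonneg (by linarith [hr i])]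
      linarith [hr' i]
    -- The factor `2 ^ k` comes from `n + 1 ≤ 2 * n`, valid since `n ≥ 1`.
    have h3 := ((summable_pow_mul_geometric_of_norm_lt_one k h2).mul_left (2 ^ k)).comp_injective
      PNat.coe_injective
    refine Summable.of_nonneg_of_le (fun _ => norm_nonneg _) (fun n => ?_) h3
    have h4 : (1 : ℝ) ≤ (n : ℕ) := by exact_mod_cast n.pos
    have h5 : (0 : ℝ) ≤ 2 * r i := by linarith [hr i]
    rw [Real.norm_of_nonneg (by positivity), Function.comp_apply, ← mul_assoc, ← mul_pow]
    gcongr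
    linarith
  refine Summable.of_nonneg_of_le (fun n => ?_) (fun n => ?_) (summable_norm_prod_and_tsum _ h1).1
  · exact mul_nonneg (Nat.cast_nonneg _) (Finset.prod_nonneg fun i _ => pow_nonneg (hr i) _)
  · refine le_trans ?_ (le_abs_self _)
    have h2 : (catalanNumber g fun i => (n i : ℕ) : ℝ) ≤
        ∏ i, ((2 : ℝ) ^ (n i : ℕ) * ((n i : ℕ) + 1 : ℝ) ^ k) := by
      exact_mod_cast catalanNumber_le_prod g fun i => (n i : ℕ)
    refine (mul_le_mul_of_nonneg_right h2
      (Finset.prod_nonneg fun i _ => pow_nonneg (hr i) _)).trans (le_of_eq ?_)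
    rw [← Finset.prod_mul_distrib]
    refine Finset.prod_congr rfl fun i _ => ?_
    rw [mul_pow]
    ring

/-- A sum weighted by Catalan numbers runs over positive degrees, except that for `(g, v) = (0, 1)`
the degree `0` contributes. -/
theorem hasSum_catalanNumber_mul {𝕜 : Type*} [RCLike 𝕜] {g v : ℕ} (hv : 1 ≤ v)
    (G : (Fin v → ℕ) → 𝕜) {s : 𝕜}
    (hs : HasSum (fun n : Fin v → ℕ+ => (catalanNumber g fun i => (n i : ℕ)) *
      G fun i => (n i : ℕ)) s) :
    HasSum (fun μ : Fin v → ℕ => (catalanNumber g μ : 𝕜) * G μ)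
      (s + if g = 0 ∧ v = 1 then G fun _ => 0 else 0) := by
  classical
  have hinj : Function.Injective fun (n : Fin v → ℕ+) (i : Fin v) => (n i : ℕ) := fun m n h =>
    funext fun i => PNat.coe_injective (congrFun h i)
  have h1 : HasSum (fun μ : Fin v → ℕ =>
      if ∀ i, μ i ≠ 0 then (catalanNumber g μ : 𝕜) * G μ else 0) s := by
    rw [← hinj.hasSum_iff]
    · simpa [Function.comp_def] using hs
    · intro μ hμ
      rw [if_neg]
      exact fun h => hμ ⟨fun i => ⟨μ i, Nat.pos_of_ne_zero (h i)⟩, rfl⟩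
  convert! h1.add (hasSum_ite_eq (fun _ => 0 : Fin v → ℕ)
    (if g = 0 ∧ v = 1 then G fun _ => 0 else 0)) using 1
  ext μ
  by_cases hμ : ∀ i, μ i ≠ 0
  · rw [if_pos hμ, if_neg, add_zero]
    rintro rfl
    exact hμ ⟨0, hv⟩ rfl
  · rw [if_neg hμ, zero_add]
    obtain ⟨i, hi⟩ : ∃ i, μ i = 0 := by simpa using hμ
    by_cases hgv : g = 0 ∧ v = 1
    · obtain ⟨rfl, rfl⟩ := hgv
      obtain rfl : μ = fun _ => 0 := funext fun j => by rw [Subsingleton.elim j i, hi]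
      simp [catalanNumber_zero]
    · rw [catalanNumber_eq_zero g μ hgv hi]
      simp [hgv]

end CatalanSums

/-! ### Interchange of the sums over `μ` and `n`. -/

section Transform

variable {b c : ℝ} {g v : ℕ}

/-- The binomials vanish outside the box `μ i ≤ n i`, so the finite sum may run over all `μ`. -/
theorem hasSum_laplaceTerm_motzkinNumber (n : Fin v → ℕ+) (x : Fin v → ℂ) :
    HasSum (fun μ : Fin v → ℕ => (catalanNumber g μ : ℂ) *
      ∏ i, laplaceKernel (b : ℂ) (c : ℂ) (x i) (μ i) (n i))
      (laplaceTerm (motzkinNumber b c g) x n) := by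
  have h1 : laplaceTerm (motzkinNumber b c g) x n =
      ∑ μ ∈ Fintype.piFinset fun i => Finset.range ((n i : ℕ) + 1), (catalanNumber g μ : ℂ) *
        ∏ i, laplaceKernel (b : ℂ) (c : ℂ) (x i) (μ i) (n i) := by
    simp only [laplaceTerm, motzkinNumber, Complex.ofReal_sum, Finset.sum_div]
    refine Finset.sum_congr rfl fun μ hμ => ?_
    have hμ' : ∀ i, μ i ≤ n i := fun i =>
      Nat.lt_succ_iff.1 (Finset.mem_range.1 (Fintype.mem_piFinset.1 hμ i))
    have h2 : ∑ i, (n i : ℕ) - ∑ i, μ i = ∑ i, ((n i : ℕ) - μ i) :=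
      (Finset.sum_tsub_distrib _ fun i _ => hμ' i).symm
    simp only [h2, laplaceKernel, Finset.prod_div_distrib, Finset.prod_mul_distrib,
      Finset.prod_pow_eq_pow_sum]
    push_cast
    ring
  rw [h1]
  refine hasSum_sum_of_ne_finset_zero fun μ hμ => ?_
  obtain ⟨i, hi⟩ : ∃ i, (n i : ℕ) < μ i := by
    simpa [Fintype.mem_piFinset, Nat.lt_succ_iff] using hμ
  rw [Finset.prod_eq_zero (Finset.mem_univ i), mul_zero]
  simp [laplaceKernel, Nat.choose_eq_zero_of_lt hi]

theorem summable_laplaceTerm_catalanReal {y : Fin v → ℂ} (hy : ∀ i, 2 < ‖y i‖) :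
    Summable (laplaceTerm (catalanReal g v) y) := by
  have h1 := summable_catalanNumber g (r := fun i => ‖y i‖⁻¹)
    (fun i => inv_nonneg.2 (norm_nonneg _))
    (fun i => by rw [one_div]; exact inv_strictAnti₀ two_pos (hy i))
  refine Summable.of_norm_bounded h1 fun n => ?_
  simp only [laplaceTerm, catalanReal, norm_prod, norm_mul, div_eq_mul_inv, ← Finset.prod_inv_distrib,
    Complex.ofReal_natCast, Complex.norm_natCast, mul_inv, inv_pow]
  refine mul_le_mul_of_nonneg_left ?_ (Nat.cast_nonneg _)
  refine Finset.prod_le_prod (fun i _ => by positivity) fun i _ => ?_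
  have h2 : (1 : ℝ) ≤ (n i : ℕ) := by exact_mod_cast (n i).pos
  rw [norm_inv, norm_inv, norm_pow, Complex.norm_natCast]
  exact mul_le_of_le_one_left (by positivity) (inv_le_one_of_one_le₀ h2)

theorem two_lt_norm (hb : 0 ≤ b) (hc : 0 < c) {x y : Fin v → ℂ}
    (hx : ∀ i, b + 2 * c < ‖x i‖) (hxy : ∀ i, x i = b + c * y i) (i : Fin v) : 2 < ‖y i‖ := by
  have h1 : ‖x i‖ ≤ b + c * ‖y i‖ := by
    rw [hxy]
    refine (norm_add_le _ _).trans ?_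
    rw [norm_mul, Complex.norm_of_nonneg hb, Complex.norm_of_nonneg hc.le]
  have h2 := hx i
  nlinarith

/-- The discrete Laplace transforms of the Motzkin numbers and of the Catalan numbers agree, up to
the contribution of the degree `0` for `(g, v) = (0, 1)`. -/
theorem hasSum_laplaceTerm (hb : 0 ≤ b) (hc : 0 < c) (hv : 1 ≤ v) {x y : Fin v → ℂ}
    (hx : ∀ i, b + 2 * c < ‖x i‖) (hxy : ∀ i, x i = b + c * y i) :
    HasSum (laplaceTerm (motzkinNumber b c g) x)
      ((∑' n, laplaceTerm (catalanReal g v) y n) +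
        if g = 0 ∧ v = 1 then ∏ i, -Complex.log (1 - b / x i) else 0) := by
  have hxb : ∀ i, b < ‖x i‖ := fun i => by linarith [hx i]
  have hbn : ‖(b : ℂ)‖ = b := by simp [abs_of_nonneg hb]
  have hc0 : (c : ℂ) ≠ 0 := by exact_mod_cast hc.ne'
  have hdiv : ∀ i, (c : ℂ) / (x i - b) = (y i)⁻¹ := fun i => by
    rw [hxy, add_sub_cancel_left, div_mul_cancel_left₀ hc0]
  -- This is the condition `‖x i‖ > b + 2 * c`, matched to the Catalan growth rate `2`.
  have hr : ∀ i, c / (‖x i‖ - b) < 1 / 2 := fun i => by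
    rw [div_lt_iff₀ (by linarith [hxb i])]
    linarith [hx i]
  have hr0 : ∀ i, 0 ≤ c / (‖x i‖ - b) := fun i => div_nonneg hc.le (by linarith [hxb i])
  have hy := two_lt_norm hb hc hx hxy
  have hk : ∀ i m, Summable fun n => ‖laplaceKernel (b : ℂ) (c : ℂ) (x i) m n‖ :=
    fun i m => summable_norm_laplaceKernel hb hc.le (hxb i) m
  -- The double family. Its norms are the same family at `‖x i‖`, as `b` and `c` are nonnegative, so
  -- the kernel sums also give absolute convergence.
  let T : (Fin v → ℕ) × (Fin v → ℕ+) → ℂ := fun p => (catalanNumber g p.1 : ℂ) *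
    ∏ i, laplaceKernel (b : ℂ) (c : ℂ) (x i) (p.1 i) (p.2 i)
  have hTnorm : ∀ μ, HasSum (fun n => ‖T (μ, n)‖) ((catalanNumber g μ : ℝ) *
      ∏ i, ∑' n, laplaceKernel b c ‖x i‖ (μ i) n) := fun μ => by
    have h1 := (hasSum_prod (fun i => laplaceKernel b c ‖x i‖ (μ i)) fun i => ?_).mul_left
      (catalanNumber g μ : ℝ)
    · simpa [T, norm_prod, norm_laplaceKernel hb hc.le] using h1
    · simpa only [← norm_laplaceKernel hb hc.le, norm_norm] using hk i (μ i)
  have hT : Summable T := by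
    refine Summable.of_norm ((summable_prod_of_nonneg fun _ => norm_nonneg _).2
      ⟨fun μ => (hTnorm μ).summable, ?_⟩)
    simp only [fun μ => (hTnorm μ).tsum_eq]
    have h1 : Summable fun n : Fin v → ℕ+ => (catalanNumber g fun i => (n i : ℕ)) *
        ∏ i, ∑' m, laplaceKernel b c ‖x i‖ (n i) m := by
      refine Summable.of_nonneg_of_le (fun n => ?_) (fun n => ?_) (summable_catalanNumber g hr0 hr)
      · exact mul_nonneg (Nat.cast_nonneg _) (Finset.prod_nonneg fun i _ => tsum_nonneg fun m =>
          norm_laplaceKernel hb hc.le (x i) (n i) m ▸ norm_nonneg _)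
      · refine mul_le_mul_of_nonneg_left (Finset.prod_le_prod (fun i _ => tsum_nonneg fun m =>
          norm_laplaceKernel hb hc.le (x i) (n i) m ▸ norm_nonneg _) fun i _ => ?_)
          (Nat.cast_nonneg _)
        rw [(hasSum_laplaceKernel c (by simpa [abs_of_nonneg hb] using hxb i) (n i).ne_zero).tsum_eq]
        exact div_le_self (pow_nonneg (hr0 i) _) (by exact_mod_cast (n i).pos)
    exact (hasSum_catalanNumber_mul hv
      (fun μ => ∏ i, ∑' m, laplaceKernel b c ‖x i‖ (μ i) m) h1.hasSum).summable
  have h1 : ∀ μ, HasSum (fun n => T (μ, n)) ((catalanNumber g μ : ℂ) *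
      ∏ i, ∑' n, laplaceKernel (b : ℂ) (c : ℂ) (x i) (μ i) n) := fun μ =>
    (hasSum_prod (fun i => laplaceKernel (b : ℂ) (c : ℂ) (x i) (μ i)) fun i => hk i _).mul_left _
  have h2 := hT.hasSum.prod_fiberwise h1
  have h3 := hasSum_catalanNumber_mul (g := g) hv
    (fun μ => ∏ i, ∑' n, laplaceKernel (b : ℂ) (c : ℂ) (x i) (μ i) n)
    (s := ∑' n, laplaceTerm (catalanReal g v) y n) (by
      convert! (summable_laplaceTerm_catalanReal hy).hasSum using 2 with n
      simp only [fun i => (hasSum_laplaceKernel (c : ℂ) (hbn.trans_lt (hxb i))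
        (n i).ne_zero).tsum_eq, hdiv, laplaceTerm, catalanReal, Complex.ofReal_natCast,
        div_eq_mul_inv, ← Finset.prod_inv_distrib, mul_inv, inv_pow, mul_comm])
  have h4 : HasSum T ((∑' n, laplaceTerm (catalanReal g v) y n) +
      if g = 0 ∧ v = 1 then ∏ i, -Complex.log (1 - b / x i) else 0) := by
    have h5 := h2.unique h3
    simp only [fun i => (hasSum_laplaceKernel_zero (c : ℂ) (hbn.trans_lt (hxb i))).tsum_eq] at h5
    exact h5 ▸ hT.hasSum
  exact ((Equiv.prodComm _ _).hasSum_iff.2 h4).prod_fiberwise fun n =>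
    hasSum_laplaceTerm_motzkinNumber n x

end Transform

/-! ### Branches of the logarithm, and comparison of the transforms. -/

theorem log_one_sub_div_add_log {b : ℝ} (hb : 0 ≤ b) {x : ℂ} (hx : b < ‖x‖) :
    Complex.log (1 - b / x) + Complex.log x = Complex.log (x - b) := by
  have hx0 : x ≠ 0 := norm_pos_iff.1 (hb.trans_lt hx)
  have hxb : x - b ≠ 0 := sub_ne_zero.2 fun h => by simp [h, abs_of_nonneg hb] at hx
  set w : ℂ := 1 - b / x with hw
  have hwx : w * x = x - b := by rw [hw]; field_simp
  have hw0 : w ≠ 0 := fun h => hxb (by rw [← hwx, h, zero_mul])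
  have hr : ‖(b : ℂ) / x‖ < 1 := by
    rw [norm_div, div_lt_one (norm_pos_iff.2 hx0), Complex.norm_of_nonneg hb]
    exact hx
  have hre : 0 < w.re := by
    have h1 := (Complex.re_le_norm ((b : ℂ) / x)).trans_lt hr
    rw [hw, Complex.sub_re, Complex.one_re]
    linarith
  rw [← hwx, Complex.log_mul hw0 hx0]
  obtain ⟨hw1, hw2⟩ := abs_lt.1 (Complex.abs_arg_lt_pi_div_two_iff.2 (Or.inl hre))
  have hx1 := Complex.neg_pi_lt_arg x
  have hx2 := Complex.arg_le_pi x
  have hpi := Real.pi_pos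
  -- As `b` is real, `w * x = x - b` keeps the imaginary part of `x`. Since `|arg w| < π / 2`, an
  -- argument sum leaving `(-π, π]` would give the sine the wrong sign.
  have him : (w * x).im = x.im := by rw [hwx]; simp
  have hsin : ‖w * x‖ * Real.sin (w.arg + x.arg) = x.im := by
    rw [← him]
    conv_rhs => rw [← Complex.norm_mul_exp_arg_mul_I w, ← Complex.norm_mul_exp_arg_mul_I x]
    rw [mul_mul_mul_comm, ← Complex.exp_add, ← add_mul, ← Complex.ofReal_add, ← Complex.ofReal_mul,
      Complex.im_ofReal_mul, Complex.exp_ofReal_mul_I_im, norm_mul]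
  rcases lt_trichotomy x.im 0 with h | h | h
  · have hx3 := Complex.arg_neg_iff.2 h
    refine ⟨?_, by linarith⟩
    by_contra hle
    have h1 : 0 ≤ Real.sin (w.arg + x.arg) := by
      rw [← Real.sin_add_two_pi]
      exact Real.sin_nonneg_of_nonneg_of_le_pi (by linarith) (by linarith)
    have h2 := mul_nonneg (norm_nonneg (w * x)) h1
    linarith
  · have hwim : w.im = 0 := by
      rw [hw, Complex.sub_im, Complex.div_im]
      simp [h]
    rw [Complex.arg_eq_zero_iff.2 ⟨hre.le, hwim⟩, zero_add]
    exact ⟨hx1, hx2⟩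
  · have hx3 := Complex.arg_nonneg_iff.2 h.le
    refine ⟨by linarith, ?_⟩
    by_contra hle
    have h1 : Real.sin (w.arg + x.arg) ≤ 0 := by
      rw [← neg_nonneg, ← Real.sin_sub_pi]
      exact Real.sin_nonneg_of_nonneg_of_le_pi (by linarith) (by linarith)
    have h2 := mul_nonpos_of_nonneg_of_nonpos (norm_nonneg (w * x)) h1
    linarith

theorem isOpen_laplaceDomain (b c : ℝ) (v : ℕ) : IsOpen (laplaceDomain b c v) := by
  rw [isOpen_iff_mem_nhds]
  intro t ht
  refine Filter.eventually_all.2 fun i => ?_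
  have h1 : ContinuousAt (fun t : Fin v → ℂ => t i ^ 2) t :=
    ((continuous_apply i).pow 2).continuousAt
  have h0 : t i ^ 2 - 1 ≠ 0 := sub_ne_zero.2 (ht i).1
  have h2 : ContinuousAt (fun t : Fin v → ℂ => ‖xOfT b c t i‖) t := by
    exact (continuousAt_const.add (continuousAt_const.mul (continuousAt_const.add
      (continuousAt_const.div (h1.sub continuousAt_const) h0)))).norm
  exact (h1.eventually_ne (ht i).1).and (h2.eventually_const_lt (ht i).2)
/-- The two discrete Laplace transforms, compared at points where the series converge. -/
theorem motzkinF_eq {b c : ℝ} (hb : 0 ≤ b) (hc : 0 < c) {g v : ℕ} (hv : 1 ≤ v) {t : Fin v → ℂ}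
    (ht : t ∈ laplaceDomain b c v) :
    motzkinF b c g v t = catalanF g v t - if g = 0 ∧ v = 1 then (Real.log c : ℂ) else 0 := by
  have hxy : ∀ i, xOfT b c t i = b + c * xOfT 0 1 t i := fun i => by simp [xOfT]
  have h1 := (hasSum_laplaceTerm (g := g) hb hc hv (fun i => (ht i).2) hxy).tsum_eq
  unfold motzkinF catalanF discreteLaplace
  rw [h1]
  by_cases hgv : g = 0 ∧ v = 1
  · simp only [if_pos hgv]
    obtain ⟨rfl, rfl⟩ := hgv
    have hb' : b < ‖xOfT b c t 0‖ := by linarith [(ht 0).2]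
    have h2 := log_one_sub_div_add_log hb hb'
    have hy : xOfT 0 1 t 0 ≠ 0 := fun h => by
      rw [hxy, h, mul_zero, add_zero, Complex.norm_of_nonneg hb] at hb'
      exact lt_irrefl _ hb'
    have h3 : Complex.log (xOfT b c t 0 - b) = Real.log c + Complex.log (xOfT 0 1 t 0) := by
      rw [hxy, add_sub_cancel_left, Complex.log_ofReal_mul hc hy]
    have hM : motzkinNumber b c 0 (fun _ : Fin 1 => 0) = 1 := by
      have : (Fintype.piFinset fun _ : Fin 1 => Finset.range (0 + 1)) = {fun _ => 0} := by
        ext μ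
        simp [funext_iff]
      rw [motzkinNumber, this, Finset.sum_singleton]
      simp [catalanNumber_zero]
    simp only [hM, catalanReal, catalanNumber_zero, Finset.univ_unique, Fin.default_eq_zero,
      Finset.prod_singleton, Finset.sum_singleton, Complex.ofReal_one, Nat.cast_one, one_mul]
    linear_combination -h2 - h3
  · simp [hgv]

end BCMotzkin


theorem mainTheorem4 (b c : ℝ) (hb : 0 ≤ b) (hc : 0 < c) (g v : ℕ) (hv : 1 ≤ v) :
    -- convergence of both multiple series, and the identity of their sums
    (∀ t ∈ BCMotzkin.laplaceDomain b c v,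
      Summable (BCMotzkin.laplaceTerm (BCMotzkin.motzkinNumber b c g) (BCMotzkin.xOfT b c t)) ∧
      Summable (BCMotzkin.laplaceTerm (BCMotzkin.catalanReal g v) (BCMotzkin.xOfT 0 1 t)) ∧
      (¬ (g = 0 ∧ v = 1) → BCMotzkin.motzkinF b c g v t = BCMotzkin.catalanF g v t) ∧
      (g = 0 ∧ v = 1 →
        BCMotzkin.motzkinF b c g v t = BCMotzkin.catalanF g v t - (Real.log c : ℂ))) ∧
    -- the same identity for all analytic continuations in the variables `t`
    (∀ (U : Set (Fin v → ℂ)) (t₀ : Fin v → ℂ) (f h : (Fin v → ℂ) → ℂ),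
      IsPreconnected U → t₀ ∈ U → t₀ ∈ BCMotzkin.laplaceDomain b c v →
      AnalyticOnNhd ℂ f U → AnalyticOnNhd ℂ h U →
      (∀ᶠ t in 𝓝 t₀, f t = BCMotzkin.motzkinF b c g v t) →
      (∀ᶠ t in 𝓝 t₀, h t = BCMotzkin.catalanF g v t) →
      (¬ (g = 0 ∧ v = 1) → ∀ t ∈ U, f t = h t) ∧
      (g = 0 ∧ v = 1 → ∀ t ∈ U, f t = h t - (Real.log c : ℂ))) := by
  have hF : ∀ t ∈ BCMotzkin.laplaceDomain b c v, BCMotzkin.motzkinF b c g v t =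
      BCMotzkin.catalanF g v t - if g = 0 ∧ v = 1 then (Real.log c : ℂ) else 0 :=
    fun t ht => BCMotzkin.motzkinF_eq hb hc hv ht
  have hU : ∀ (U : Set (Fin v → ℂ)) (t₀ : Fin v → ℂ) (f h : (Fin v → ℂ) → ℂ),
      IsPreconnected U → t₀ ∈ U → t₀ ∈ BCMotzkin.laplaceDomain b c v →
      AnalyticOnNhd ℂ f U → AnalyticOnNhd ℂ h U →
      (∀ᶠ t in 𝓝 t₀, f t = BCMotzkin.motzkinF b c g v t) →
      (∀ᶠ t in 𝓝 t₀, h t = BCMotzkin.catalanF g v t) →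
      ∀ t ∈ U, f t = h t - if g = 0 ∧ v = 1 then (Real.log c : ℂ) else 0 := by
    intro U t₀ f h hU ht₀ htD hf hh hfM hhC
    refine hf.eqOn_of_preconnected_of_eventuallyEq (hh.sub analyticOnNhd_const) hU ht₀ ?_
    filter_upwards [hfM, hhC, (BCMotzkin.isOpen_laplaceDomain b c v).mem_nhds htD] with t h1 h2 h3
    rw [h1, hF t h3, ← h2]
  refine ⟨fun t ht => ⟨?_, ?_, fun hgv => ?_, fun hgv => ?_⟩,
    fun U t₀ f h hUc ht₀ htD hf hh hfM hhC => ⟨fun hgv t ht => ?_, fun hgv t ht => ?_⟩⟩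
  · exact (BCMotzkin.hasSum_laplaceTerm hb hc hv (fun i => (ht i).2)
      (fun i => by simp [BCMotzkin.xOfT] : ∀ i, BCMotzkin.xOfT b c t i =
        b + c * BCMotzkin.xOfT 0 1 t i)).summable
  · exact BCMotzkin.summable_laplaceTerm_catalanReal
      (BCMotzkin.two_lt_norm hb hc (fun i => (ht i).2) fun i => by simp [BCMotzkin.xOfT])
  · rw [hF t ht, if_neg hgv, sub_zero]
  · rw [hF t ht, if_pos hgv]
  · rw [hU U t₀ f h hUc ht₀ htD hf hh hfM hhC t ht, if_neg hgv, sub_zero]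
  · rw [hU U t₀ f h hUc ht₀ htD hf hh hfM hhC t ht, if_pos hgv]
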